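/- Let $p\ge 1$, $\boldsymbol\mu\in\mathbb R^p$, and $\mathbf X_i=\boldsymbol\mu+\boldsymbol\epsilon_i$, $i=1,2,\dots$, where the errors $\boldsymbol\epsilon_i=(\epsilon_{i1},\dots,\epsilon_{ip})$ are i.i.d. random vectors in $\mathbb R^p$ with zero mean that belong to $DS(\alpha_1,\dots,\alpha_p)$ with $1<\alpha_j\le 2$ for all $j$. This means that there are $a_n^{(j)}>0$ and $\mathbf b_n\in\mathbb R^p$ such that $$\Big(\sum_{i=1}^n\epsilon_{i1}/a_n^{(1)},\dots,\sum_{i=1}^n\epsilon_{ip}/a_n^{(p)}\Big)-\mathbf b_n\xrightarrow{d}\mathbf Y,$$ where $\mathbf Y$ has a stable law with indices $(\alpha_1,\dots,\alpha_p)$: its coordinates are non-degenerate, and for every $n\ge1$ the sum of $n$ independent copies of $\mathbf Y$ has the same law as $(n^{1/\alpha_1}Y_1,\dots,n^{1/\alpha_p}Y_p)+\mathbf c_n$ for some $\mathbf c_n\in\mathbb R^p$. Let $\rho(x_1,\dots,x_p)=\rho_1(x_1)+\dots+\rho_p(x_p)$ where, for each $j=1,\dots,p$: (A1) $\rho_j:\mathbb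 R\to\mathbb R$ is convex and twice differentiable; put $\psi_j=\rho_j'$, $\psi_j'=\rho_j''$; (A2) $E\,\psi_j(\epsilon_{1j})=0$, $E\,\psi_j^2(\epsilon_{1j})<\infty$ and $0<|E\,\psi_j'(\epsilon_{1j})|<\infty$; (A3) $\psi_j'$ is Lipschitz continuous on $\mathbb R$. For each $n$ let $\hat{\boldsymbol\mu}_M=\hat{\boldsymbol\mu}_{M,n}$ be an M-estimator, that is, a random vector that almost surely minimizes $\boldsymbol\beta\mapsto\sum_{i=1}^n\rho(\mathbf X_i-\boldsymbol\beta)$ over $\mathbb R^p$. Then, as $n\to\infty$, $$\sqrt n\,(\hat{\boldsymbol\mu}_M-\boldsymbol\mu)\xrightarrow{d}N\big(\mathbf 0,\ \digamma^{-1}\Gamma\digamma^{-1}\big),$$ where $\digamma=\mathrm{diag}\big(E\,\psi_1'(\epsilon_{11}),\dots,E\,\psi_p'(\epsilon_{1p})\big)$ and $\Gamma=(\gamma_{jk})$ is the $p\times p$ matrix with $\gamma_{jk}=\mathrm{Cov}\big(\psi_j(\epsilon_{1j}),\psi_k(\epsilon_{1k})\big)=E\big[\psi_j(\epsilon_{1j})\psi_k(\epsilon_{1k})\big]$.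 -/

import Mathlib

open MeasureTheory ProbabilityTheory Filter Topology

/-- `ν` is a stable law on `ℝᵖ` with (possibly different) indices of stability `α₁, …, α_p`:
all one-dimensional marginals are non-degenerate and, for every `n ≥ 1`, the sum of `n` independent
vectors with law `ν` has the law of `(n^{1/α₁} Y₁ + c₁, …, n^{1/α_p} Y_p + c_p)`, where `Y ∼ ν`
and `c` is a constant vector depending on `n`. -/
structure IsStableLaw {p : ℕ} (α : Fin p → ℝ) (ν : Measure (EuclideanSpace ℝ (Fin p))) :
    Prop where
  index_mem : ∀ j, α j ∈ Set.Ioc (0 : ℝ) 2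
  nondegenerate : ∀ (j : Fin p) (c : ℝ), ¬ ∀ᵐ y ∂ν, y j = c
  stable : ∀ n : ℕ, 1 ≤ n → ∃ c : Fin p → ℝ,
    (Measure.pi fun _ : Fin n => ν).map (fun y => ∑ i, y i) =
      ν.map (fun y => WithLp.toLp 2 fun j => (n : ℝ) ^ (1 / α j) * y j + c j)

/-- The i.i.d. random vectors `ξ 0, ξ 1, …` belong to `DS(α₁, …, α_p)`: with coordinatewise
positive norming constants `a n j` and centring vectors `b n`, the vector of normalised coordinates
of the partial sums converges in distribution to a stable law with indices `α₁, …, α_p`. -/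
def InDS {p : ℕ} (α : Fin p → ℝ) {Ω : Type*} [MeasurableSpace Ω] (P : Measure Ω)
    [IsProbabilityMeasure P] (ξ : ℕ → Ω → EuclideanSpace ℝ (Fin p)) : Prop :=
  ∃ (ν : ProbabilityMeasure (EuclideanSpace ℝ (Fin p))) (a b : ℕ → Fin p → ℝ),
    IsStableLaw α (ν : Measure (EuclideanSpace ℝ (Fin p))) ∧
    (∀ n j, 0 < a n j) ∧
    TendstoInDistribution
      (fun n ω => WithLp.toLp 2 fun j => (∑ i ∈ Finset.range n, ξ i ω j) / a n j - b n j)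
      atTop id (fun _ => P) (ν : Measure (EuclideanSpace ℝ (Fin p)))

/-- The separable loss `ρ(x₁, …, x_p) = ρ₁(x₁) + ⋯ + ρ_p(x_p)`. -/
def separableLoss {p : ℕ} (ρ : Fin p → ℝ → ℝ) (x : EuclideanSpace ℝ (Fin p)) : ℝ :=
  ∑ j, ρ j (x j)

/-- `β` is an M-estimate from the observations `x 0, …, x (n - 1)`: it minimises
`b ↦ ∑ i < n, ρ (x i - b)` over `ℝᵖ`. -/
def IsMEstimate {p : ℕ} (ρ : Fin p → ℝ → ℝ) (n : ℕ) (x : ℕ → EuclideanSpace ℝ (Fin p))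
    (β : EuclideanSpace ℝ (Fin p)) : Prop :=
  IsMinOn (fun b => ∑ i ∈ Finset.range n, separableLoss ρ (x i - b)) Set.univ β

/-- The matrix `diag(E ψ₁'(ε₁), …, E ψ_p'(ε_p))` with `ψ_j = ρ_j'`. -/
noncomputable def digammaMatrix {p : ℕ} (ρ : Fin p → ℝ → ℝ) {Ω : Type*} [MeasurableSpace Ω]
    (P : Measure Ω) (e : Ω → EuclideanSpace ℝ (Fin p)) : Matrix (Fin p) (Fin p) ℝ :=
  Matrix.diagonal fun j => ∫ ω, deriv (deriv (ρ j)) (e ω j) ∂P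

/-- The matrix with entries `E[ψ_j(ε_j) ψ_k(ε_k)]`, with `ψ_j = ρ_j'`. -/
noncomputable def gammaMatrix {p : ℕ} (ρ : Fin p → ℝ → ℝ) {Ω : Type*} [MeasurableSpace Ω]
    (P : Measure Ω) (e : Ω → EuclideanSpace ℝ (Fin p)) : Matrix (Fin p) (Fin p) ℝ :=
  Matrix.of fun j k => ∫ ω, deriv (ρ j) (e ω j) * deriv (ρ k) (e ω k) ∂P

/-- The sandwich covariance matrix `Ϝ⁻¹ Γ Ϝ⁻¹`. -/
noncomputable def asymptoticCov {p : ℕ} (ρ : Fin p → ℝ → ℝ) {Ω : Type*} [MeasurableSpace Ω]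
    (P : Measure Ω) (e : Ω → EuclideanSpace ℝ (Fin p)) : Matrix (Fin p) (Fin p) ℝ :=
  (digammaMatrix ρ P e)⁻¹ * gammaMatrix ρ P e * (digammaMatrix ρ P e)⁻¹

/-! ### Multivariate central limit theorem -/

section CentralLimit

variable {ι Ω : Type*} [Fintype ι] [MeasurableSpace Ω] {P : Measure Ω} [IsProbabilityMeasure P]

/-! The loss separates, so a minimiser satisfies one scalar equation `∑ ψ (ξ i - δ) = 0` per
coordinate. On the scale `v = √n δ`, Lipschitz continuity of `ψ'` turns the normalised score into `Z
- v A + O(v² / √n)`, where `Z` is the normalised sum of `ψ (ξ i)` and `A → d = E ψ'` by the law of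
large numbers. Convexity makes the score decreasing in `v`, so sign changes at `±M` trap every root,
with no prior consistency proof (`abs_root_sub_div_le`). Hence `√n δ = Z / d + o_P(1)`
(`tendstoInMeasure_sqrt_mul_root_sub`). The vector of the `Z / d` is a normalised i.i.d. sum, so the
central limit theorem and Slutsky's lemma conclude. -/

/-- The covariance form of a square integrable random vector is the variance of the
corresponding linear combination of its coordinates. -/
lemma dotProduct_covariance_mulVec_eq_variance {W : ι → Ω → ℝ} (hW : ∀ j, MemLp (W j) 2 P)
    (t : ι → ℝ) :
    t ⬝ᵥ (Matrix.of fun j k => cov[W j, W k; P]).mulVec t = Var[fun ω => ∑ j, t j * W j ω; P] := by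
  have h : (fun ω => ∑ j, t j * W j ω) = ∑ j, fun ω => t j * W j ω := by
    ext ω; simp
  rw [h, variance_sum fun j => (hW j).const_mul (t j)]
  simp only [dotProduct, Matrix.mulVec, Matrix.of_apply, covariance_const_mul_left,
    covariance_const_mul_right, Finset.mul_sum]
  exact Finset.sum_congr rfl fun j _ => Finset.sum_congr rfl fun k _ => by ring

lemma posSemidef_covariance {W : ι → Ω → ℝ} (hW : ∀ j, MemLp (W j) 2 P) :
    (Matrix.of fun j k => cov[W j, W k; P]).PosSemidef := by
  refine Matrix.PosSemidef.of_dotProduct_mulVec_nonneg ?_ fun t => ?_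
  · ext j k
    simp [covariance_comm (W k)]
  · rw [star_trivial, dotProduct_covariance_mulVec_eq_variance hW]
    exact variance_nonneg _ _

/-- The **multivariate central limit theorem** for centred, square integrable, i.i.d. vectors. -/
theorem tendstoInDistribution_inv_sqrt_smul_sum [DecidableEq ι] {W : ℕ → Ω → EuclideanSpace ℝ ι}
    (hindep : iIndepFun W P) (hident : ∀ i, IdentDistrib (W i) (W 0) P P)
    (hL2 : ∀ j, MemLp (fun ω => W 0 ω j) 2 P) (hmean : ∀ j, ∫ ω, W 0 ω j ∂P = 0) :
    TendstoInDistribution (fun (n : ℕ) ω => (√(n : ℝ))⁻¹ • ∑ i ∈ Finset.range n, W i ω) atTop id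
      (fun _ => P) (multivariateGaussian 0
        (Matrix.of fun j k => cov[fun ω => W 0 ω j, fun ω => W 0 ω k; P])) := by
  have hW (i : ℕ) : AEMeasurable (W i) P := (hident i).aemeasurable_fst
  have hmeas (n : ℕ) : AEMeasurable
      (fun ω => (√(n : ℝ))⁻¹ • ∑ i ∈ Finset.range n, W i ω) P := by fun_prop
  refine ⟨hmeas, aemeasurable_id, ?_⟩
  refine ProbabilityMeasure.tendsto_iff_tendsto_charFun.2 fun t => ?_
  have hinner (x : EuclideanSpace ℝ ι) : inner ℝ x t = ∑ j, t j * x j := by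
    simp [PiLp.inner_apply]
  set V : ℕ → Ω → ℝ := fun i ω => inner ℝ (W i ω) t with hV
  have hm : Measurable fun x : EuclideanSpace ℝ ι => (inner ℝ x t : ℝ) := by fun_prop
  have hVL2 : MemLp (V 0) 2 P := by
    simp only [hV, hinner]
    exact memLp_finsetSum _ fun j _ => (hL2 j).const_mul (t j)
  have hVmean : P[V 0] = 0 := by
    simp only [hV, hinner]
    rw [integral_finsetSum _ fun j _ =>
      ((hL2 j).integrable (by norm_num)).const_mul (t j)]
    simp [integral_const_mul, hmean]
  have hclt := tendstoInDistribution_inv_sqrt_mul_sum_sub (P := P) (X := V)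
    (HasLaw.id (μ := gaussianReal 0 Var[V 0; P].toNNReal)) hVL2
    (hindep.comp (fun _ x => (inner ℝ x t : ℝ)) fun _ => hm)
    (fun i => (hident i).comp hm)
  -- Cramér–Wold: the characteristic function of the projection onto `t`, taken at 1, is that of the
  -- vector at `t`.
  have hchar := ProbabilityMeasure.tendsto_iff_tendsto_charFun.1 hclt.tendsto 1
  simp only [ProbabilityMeasure.coe_mk, Measure.map_id] at hchar ⊢
  convert hchar using 2
  · rw [charFun_apply, charFun_apply, integral_map (hmeas _) (by fun_prop), integral_map
      (hclt.forall_aemeasurable _) (by fun_prop)]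
    simp only [hVmean, mul_zero, sub_zero]
    simp [hV, inner_smul_left, sum_inner]
  · rw [charFun_multivariateGaussian (posSemidef_covariance hL2), charFun_gaussianReal,
      dotProduct_covariance_mulVec_eq_variance hL2]
    have : Var[V 0; P] = Var[fun ω => ∑ j, t j * W 0 ω j; P] := by simp only [hV, hinner]
    simp [← this, variance_nonneg]

end CentralLimit

section CoordinateConvergence

/-- The norm is at most the sum of the absolute coordinates, so a large vector has a large
coordinate; a union bound finishes. The `+ 1` in the threshold also covers empty `ι`. -/
lemma tendstoInMeasure_zero_of_coordinates {ι κ Ω : Type*} [Fintype ι] [MeasurableSpace Ω]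
    {P : Measure Ω} {l : Filter κ} {D : κ → Ω → EuclideanSpace ℝ ι}
    (h : ∀ j, TendstoInMeasure P (fun n ω => D n ω j) l 0) : TendstoInMeasure P D l 0 := by
  simp only [tendstoInMeasure_iff_norm, Pi.zero_apply, sub_zero] at h ⊢
  intro η hη
  set c : ℝ := η / (Fintype.card ι + 1)
  have hc : 0 < c := by positivity
  have hsum : Tendsto (fun n => ∑ j, P {ω | c ≤ ‖D n ω j‖}) l (𝓝 0) := by
    simpa using tendsto_finsetSum Finset.univ fun j _ => h j c hc
  refine tendsto_of_tendsto_of_tendsto_of_le_of_le tendsto_const_nhds hsum (fun _ => zero_le)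
    fun n => (measure_mono fun ω hω => ?_).trans (measure_iUnion_fintype_le P _)
  by_contra hcon
  simp only [Set.mem_iUnion, Set.mem_ofPred_eq, not_exists, not_le] at hcon hω
  have h1 : ‖D n ω‖ ≤ ∑ j, ‖D n ω j‖ := by
    conv_lhs => rw [← (EuclideanSpace.basisFun ι ℝ).sum_repr (D n ω)]
    refine (norm_sum_le _ _).trans (Finset.sum_le_sum fun j _ => ?_)
    simp [norm_smul]
  have h2 : ∑ j, ‖D n ω j‖ ≤ Fintype.card ι * c := by
    simpa using Finset.sum_le_card_nsmul Finset.univ _ c fun j _ => (hcon j).le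
  have h3 : (Fintype.card ι + 1) * c = η := by simp only [c]; field_simp
  linarith

end CoordinateConvergence

/-! ### Asymptotic linearity of roots of monotone scores -/

section Linearization

/-- First-order Taylor bound for a function with Lipschitz derivative. -/
lemma abs_sub_taylor_le {ψ : ℝ → ℝ} (hψ : Differentiable ℝ ψ) {K : NNReal}
    (hlip : LipschitzWith K (deriv ψ)) (x t : ℝ) :
    |ψ (x - t) - (ψ x - t * deriv ψ x)| ≤ K * t ^ 2 := by
  have hderiv (s : ℝ) : HasDerivAt (fun s => ψ (x - s) + s * deriv ψ x)
      (-deriv ψ (x - s) + deriv ψ x) s := by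
    have h1 := (hψ (x - s)).hasDerivAt.comp s ((hasDerivAt_id s).const_sub x)
    exact (h1.fun_add ((hasDerivAt_id s).mul_const (deriv ψ x))).congr_deriv (by ring)
  have hbound : ∀ s ∈ Set.uIcc 0 t, ‖-deriv ψ (x - s) + deriv ψ x‖ ≤ K * |t| := by
    intro s hs
    have h1 := hlip.dist_le_mul x (x - s)
    rw [Real.dist_eq, Real.dist_eq, sub_sub_cancel] at h1
    rw [Real.norm_eq_abs, neg_add_eq_sub]
    have h2 : |s| ≤ |t| := by simpa using Set.abs_sub_left_of_mem_uIcc hs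
    exact h1.trans (by gcongr)
  have h := (convex_uIcc 0 t).norm_image_sub_le_of_norm_hasDerivWithin_le
    (fun s _ => (hderiv s).hasDerivWithinAt) hbound Set.left_mem_uIcc Set.right_mem_uIcc
  have e : ψ (x - t) + t * deriv ψ x - (ψ (x - 0) + 0 * deriv ψ x) =
      ψ (x - t) - (ψ x - t * deriv ψ x) := by rw [sub_zero]; ring
  rw [e, Real.norm_eq_abs, Real.norm_eq_abs, sub_zero, mul_assoc, abs_mul_abs_self] at h
  simpa [sq] using h

/-- A zero `u` of a decreasing function that is close to `v ↦ Z - v * A` is close to `Z / d`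
when `A` is close to `d`. -/
lemma abs_root_sub_div_le {F : ℝ → ℝ} (hF : Antitone F) {Z A d κ M τ u : ℝ} (hd : 0 < d)
    (hM : 0 < M) (hκ : 0 ≤ κ) (happrox : ∀ v, |F v - (Z - v * A)| ≤ κ * v ^ 2) (hu : F u = 0)
    (hZ : |Z| < M * d / 4) (hA : |A - d| < τ) (hτ : τ ≤ d / 2) (hκM : κ * M ^ 2 < M * d / 4) :
    |u - Z / d| ≤ (M * τ + κ * M ^ 2) / d := by
  rw [abs_lt] at hZ hA
  have hMA : M * d / 2 ≤ M * A := by nlinarith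
  -- At `±M` the linear term has size at least `M * d / 2`, which beats `|Z|` and the remainder,
  -- each below `M * d / 4`.
  have h1 := abs_le.1 (happrox M)
  have h2 := abs_le.1 (happrox (-M))
  have hneg : F M < 0 := by linarith
  have hpos : 0 < F (-M) := by rw [neg_sq] at h2; linarith
  have hu1 : u ≤ M := by
    by_contra! h
    linarith [hF h.le]
  have hu2 : -M ≤ u := by
    by_contra! h
    linarith [hF h.le]
  have husq : u ^ 2 ≤ M ^ 2 := sq_le_sq' hu2 hu1
  have h3 := happrox u
  rw [hu, zero_sub, neg_sub] at h3
  have h4 : |u * (d - A)| ≤ M * τ := by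
    rw [abs_mul]
    refine mul_le_mul (abs_le.2 ⟨hu2, hu1⟩) ?_ (abs_nonneg _) hM.le
    rw [abs_sub_comm]
    exact (abs_lt.2 hA).le
  have e : u - Z / d = (u * (d - A) + (u * A - Z)) / d := by field_simp; ring
  rw [e, abs_div, abs_of_pos hd]
  gcongr
  exact (abs_add_le _ _).trans (add_le_add h4 (h3.trans (by gcongr)))

variable {Ω : Type*} [MeasurableSpace Ω] {P : Measure Ω} [IsProbabilityMeasure P]

/-- Chebyshev's inequality for normalised sums of centred i.i.d. variables. -/
lemma measure_le_abs_inv_sqrt_mul_sum_le {V : ℕ → Ω → ℝ} (hindep : iIndepFun V P)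
    (hident : ∀ i, IdentDistrib (V i) (V 0) P P) (hL2 : MemLp (V 0) 2 P)
    (hmean : ∫ ω, V 0 ω ∂P = 0) {n : ℕ} (hn : 0 < n) {c : ℝ} (hc : 0 < c) :
    P {ω | c ≤ |(√(n : ℝ))⁻¹ * ∑ i ∈ Finset.range n, V i ω|} ≤
      ENNReal.ofReal (Var[V 0; P] / c ^ 2) := by
  have hL (i : ℕ) : MemLp (V i) 2 P := (hident i).memLp_iff.2 hL2
  have hS : MemLp (fun ω => ∑ i ∈ Finset.range n, V i ω) 2 P := memLp_finsetSum _ fun i _ => hL i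
  have hvar : Var[fun ω => (√(n : ℝ))⁻¹ * ∑ i ∈ Finset.range n, V i ω; P] = Var[V 0; P] := by
    have e : (fun ω => ∑ i ∈ Finset.range n, V i ω) = ∑ i ∈ Finset.range n, V i := by
      ext ω; simp
    rw [variance_const_mul, e, IndepFun.variance_sum (fun i _ => hL i)
      fun i _ j _ hij => hindep.indepFun hij]
    simp only [(hident _).variance_eq, Finset.sum_const, Finset.card_range, nsmul_eq_mul, inv_pow,
      Real.sq_sqrt (Nat.cast_nonneg n)]
    field_simp
  have hzero : ∫ ω, (√(n : ℝ))⁻¹ * ∑ i ∈ Finset.range n, V i ω ∂P = 0 := by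
    rw [integral_const_mul, integral_finsetSum _ fun i _ => (hL i).integrable (by norm_num)]
    simp [(hident _).integral_eq, hmean]
  have h := meas_ge_le_variance_div_sq (hS.const_mul (√(n : ℝ))⁻¹) hc
  simpa only [hvar, hzero, sub_zero] using h

/-- Asymptotic linearity of a root `δ n` of the estimating equation `∑ ψ (ξ i - δ n) = 0` with
increasing score `ψ`. -/
theorem tendstoInMeasure_sqrt_mul_root_sub {ξ : ℕ → Ω → ℝ} (hindep : iIndepFun ξ P)
    (hident : ∀ i, IdentDistrib (ξ i) (ξ 0) P P) {ψ : ℝ → ℝ} (hmono : Monotone ψ)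
    (hψ : Differentiable ℝ ψ) {K : NNReal} (hlip : LipschitzWith K (deriv ψ))
    (hL2 : MemLp (fun ω => ψ (ξ 0 ω)) 2 P) (hmean : ∫ ω, ψ (ξ 0 ω) ∂P = 0)
    (hint : Integrable (fun ω => deriv ψ (ξ 0 ω)) P) (hpos : 0 < ∫ ω, deriv ψ (ξ 0 ω) ∂P)
    {δ : ℕ → Ω → ℝ} (hδ : ∀ n, ∀ᵐ ω ∂P, ∑ i ∈ Finset.range n, ψ (ξ i ω - δ n ω) = 0) :
    TendstoInMeasure P (fun (n : ℕ) ω => √(n : ℝ) * δ n ω -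
      ((√(n : ℝ))⁻¹ * ∑ i ∈ Finset.range n, ψ (ξ i ω)) / ∫ ω, deriv ψ (ξ 0 ω) ∂P) atTop 0 := by
  set d := ∫ ω, deriv ψ (ξ 0 ω) ∂P with hd
  have hψm : Measurable ψ := hψ.continuous.measurable
  have hψ'm : Measurable (deriv ψ) := hlip.continuous.measurable
  have hlln : TendstoInMeasure P
      (fun (n : ℕ) ω => (∑ i ∈ Finset.range n, deriv ψ (ξ i ω)) / n) atTop (fun _ => d) := by
    refine tendstoInMeasure_of_tendsto_ae (fun n => ?_) ?_
    · have (i : ℕ) : AEMeasurable (ξ i) P := (hident i).aemeasurable_fst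
      exact AEMeasurable.aestronglyMeasurable (by fun_prop)
    · exact strong_law_ae_real (fun i ω => deriv ψ (ξ i ω)) hint
        (fun i j hij => (hindep.indepFun hij).comp hψ'm hψ'm) (fun i => (hident i).comp hψ'm)
  simp only [tendstoInMeasure_iff_norm, Pi.zero_apply, sub_zero, Real.norm_eq_abs] at hlln ⊢
  intro η hη
  rw [ENNReal.tendsto_nhds_zero]
  intro r hr
  -- The Chebyshev bound is free of `n`, so one `M` serves all sample sizes.
  obtain ⟨M, hM, hMr⟩ : ∃ M : ℝ, 0 < M ∧
      ENNReal.ofReal (Var[fun ω => ψ (ξ 0 ω); P] / (M * d / 4) ^ 2) ≤ r / 2 := by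
    have hlim : Tendsto (fun M : ℝ =>
        ENNReal.ofReal (Var[fun ω => ψ (ξ 0 ω); P] / (M * d / 4) ^ 2)) atTop (𝓝 0) := by
      rw [← ENNReal.ofReal_zero]
      refine ENNReal.tendsto_ofReal (Tendsto.div_atTop tendsto_const_nhds ?_)
      exact (tendsto_pow_atTop two_ne_zero).comp
        ((tendsto_id.atTop_mul_const hpos).atTop_div_const (by norm_num))
    obtain ⟨M, h1, h2⟩ := ((eventually_gt_atTop (0 : ℝ)).and
      (ENNReal.tendsto_nhds_zero.1 hlim (r / 2) (ENNReal.half_pos hr.ne'))).exists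
    exact ⟨M, h1, h2⟩
  -- The first bound keeps the slope above `d / 2`; the second limits the slope error to `η / 4`
  -- after division by `d`.
  set τ := min (d / 2) (η * d / (4 * M))
  have hτ : 0 < τ := by positivity
  have hτM : M * τ ≤ η * d / 4 := by
    calc M * τ ≤ M * (η * d / (4 * M)) := by gcongr; exact min_le_right _ _
      _ = η * d / 4 := by field_simp
  have hκ : Tendsto (fun n : ℕ => (K : ℝ) / √(n : ℝ) * M ^ 2) atTop (𝓝 0) := by
    rw [← zero_mul (M ^ 2)]
    exact (tendsto_const_nhds.div_atTop
      (Real.tendsto_sqrt_atTop.comp tendsto_natCast_atTop_atTop)).mul_const _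
  filter_upwards [ENNReal.tendsto_nhds_zero.1 (hlln τ hτ) (r / 2) (ENNReal.half_pos hr.ne'),
    hκ.eventually_lt_const (show 0 < M * d / 4 by positivity),
    hκ.eventually_lt_const (show 0 < η * d / 4 by positivity), eventually_gt_atTop 0]
    with n hA hκ1 hκ2 hn
  have hZ := (measure_le_abs_inv_sqrt_mul_sum_le (V := fun i ω => ψ (ξ i ω))
    (hindep.comp (fun _ => ψ) fun _ => hψm) (fun i => (hident i).comp hψm) hL2 hmean hn
    (show 0 < M * d / 4 by positivity)).trans hMr
  rw [← ENNReal.add_halves r]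
  refine (measure_mono_ae ?_).trans ((measure_union_le _ _).trans (add_le_add hZ hA))
  filter_upwards [hδ n] with ω hω hbad
  by_contra hcon
  change η ≤ _ at hbad
  change ¬ (M * d / 4 ≤ _ ∨ τ ≤ _) at hcon
  obtain ⟨hc1, hc2⟩ : _ < M * d / 4 ∧ _ < τ := by simpa only [not_or, not_le] using hcon
  have hn' : (0 : ℝ) < n := by exact_mod_cast hn
  have hs : 0 < √(n : ℝ) := Real.sqrt_pos.2 hn'
  have hss : √(n : ℝ) * √(n : ℝ) = n := Real.mul_self_sqrt hn'.le
  have key := abs_root_sub_div_le (κ := K / √(n : ℝ)) (u := √(n : ℝ) * δ n ω)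
    (F := fun v => (√(n : ℝ))⁻¹ * ∑ i ∈ Finset.range n, ψ (ξ i ω - v / √(n : ℝ)))
    (fun v w hvw => mul_le_mul_of_nonneg_left
      (Finset.sum_le_sum fun i _ => hmono (by gcongr)) (by positivity))
    hpos hM (by positivity) (fun v => ?_) ?_ hc1 hc2 (min_le_left _ _) hκ1
  · have h5 : (M * τ + K / √(n : ℝ) * M ^ 2) / d < η := by
      rw [div_lt_iff₀ hpos]
      nlinarith [mul_pos hη hpos]
    linarith
  · have e : (√(n : ℝ))⁻¹ * ∑ i ∈ Finset.range n, ψ (ξ i ω - v / √(n : ℝ)) -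
        ((√(n : ℝ))⁻¹ * ∑ i ∈ Finset.range n, ψ (ξ i ω) -
          v * ((∑ i ∈ Finset.range n, deriv ψ (ξ i ω)) / n)) =
        (√(n : ℝ))⁻¹ * ∑ i ∈ Finset.range n, (ψ (ξ i ω - v / √(n : ℝ)) -
          (ψ (ξ i ω) - v / √(n : ℝ) * deriv ψ (ξ i ω))) := by
      rw [Finset.sum_sub_distrib, Finset.sum_sub_distrib, ← Finset.mul_sum]
      have hv : v * ((∑ i ∈ Finset.range n, deriv ψ (ξ i ω)) / n) =
          (√(n : ℝ))⁻¹ * (v / √(n : ℝ) * ∑ i ∈ Finset.range n, deriv ψ (ξ i ω)) := by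
        rw [← congrArg ((∑ i ∈ Finset.range n, deriv ψ (ξ i ω)) / ·) hss]
        field_simp
      rw [hv]
      ring
    rw [e, abs_mul, abs_of_pos (inv_pos.2 hs)]
    calc (√(n : ℝ))⁻¹ * |∑ i ∈ Finset.range n, (ψ (ξ i ω - v / √(n : ℝ)) -
          (ψ (ξ i ω) - v / √(n : ℝ) * deriv ψ (ξ i ω)))|
        ≤ (√(n : ℝ))⁻¹ * ∑ i ∈ Finset.range n, (K : ℝ) * (v / √(n : ℝ)) ^ 2 := by
          gcongr
          exact (Finset.abs_sum_le_sum_abs _ _).trans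
            (Finset.sum_le_sum fun i _ => abs_sub_taylor_le hψ hlip _ _)
      _ = K / √(n : ℝ) * v ^ 2 := by
          rw [Finset.sum_const, Finset.card_range, nsmul_eq_mul, div_pow, Real.sq_sqrt hn'.le]
          field_simp
  · simp [mul_div_cancel_left₀ _ hs.ne', hω]

end Linearization

/-! ### Estimating equations and the sandwich matrix -/

section MEstimation

variable {p : ℕ}

/-- The coordinatewise estimating equation satisfied by an M-estimate. -/
lemma IsMEstimate.sum_deriv_eq_zero {ρ : Fin p → ℝ → ℝ} (hdiff : ∀ j, Differentiable ℝ (ρ j))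
    {n : ℕ} {x : ℕ → EuclideanSpace ℝ (Fin p)} {β : EuclideanSpace ℝ (Fin p)}
    (h : IsMEstimate ρ n x β) (j : Fin p) :
    ∑ i ∈ Finset.range n, deriv (ρ j) (x i j - β j) = 0 := by
  have hpath (k : Fin p) : HasDerivAt (fun s : ℝ => (β + s • EuclideanSpace.single j (1 : ℝ)) k)
      (if k = j then 1 else 0) 0 := by
    have h1 := ((hasDerivAt_id (0 : ℝ)).mul_const (if k = j then (1 : ℝ) else 0)).const_add (β k)
    simpa using h1
  have hterm (i : ℕ) (k : Fin p) : HasDerivAt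
      (fun s : ℝ => ρ k ((x i - (β + s • EuclideanSpace.single j (1 : ℝ))) k))
      (deriv (ρ k) (x i k - β k) * -(if k = j then 1 else 0)) 0 := by
    have h1 := (hdiff k (x i k - (β + (0 : ℝ) • EuclideanSpace.single j (1 : ℝ)) k)).hasDerivAt.comp
      (0 : ℝ) ((hpath k).const_sub (x i k))
    simp only [zero_smul, add_zero] at h1
    exact h1
  have hsum := HasDerivAt.fun_sum fun i (_ : i ∈ Finset.range n) =>
    HasDerivAt.fun_sum fun k (_ : k ∈ Finset.univ) => hterm i k
  have hmin : IsLocalMin (fun s : ℝ => ∑ i ∈ Finset.range n,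
      ∑ k, ρ k ((x i - (β + s • EuclideanSpace.single j (1 : ℝ))) k)) 0 := by
    refine Eventually.of_forall fun s => ?_
    simpa [separableLoss] using h (Set.mem_univ (β + s • EuclideanSpace.single j (1 : ℝ)))
  simpa using hmin.hasDerivAt_eq_zero hsum

variable {Ω : Type*} [MeasurableSpace Ω] {P : Measure Ω}

lemma asymptoticCov_apply {ρ : Fin p → ℝ → ℝ} {e : Ω → EuclideanSpace ℝ (Fin p)}
    (h : ∀ j, ∫ ω, deriv (deriv (ρ j)) (e ω j) ∂P ≠ 0) (j k : Fin p) :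
    asymptoticCov ρ P e j k = (∫ ω, deriv (deriv (ρ j)) (e ω j) ∂P)⁻¹ * gammaMatrix ρ P e j k *
      (∫ ω, deriv (deriv (ρ k)) (e ω k) ∂P)⁻¹ := by
  have hinv : (digammaMatrix ρ P e)⁻¹ =
      Matrix.diagonal fun j => (∫ ω, deriv (deriv (ρ j)) (e ω j) ∂P)⁻¹ := by
    refine Matrix.inv_eq_right_inv ?_
    rw [digammaMatrix, Matrix.diagonal_mul_diagonal, ← Matrix.diagonal_one]
    exact congrArg _ (funext fun j => mul_inv_cancel₀ (h j))
  rw [asymptoticCov, hinv, Matrix.mul_diagonal, Matrix.diagonal_mul]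

end MEstimation

theorem theorem1 {p : ℕ} {Ω : Type*} [MeasurableSpace Ω] (P : Measure Ω) [IsProbabilityMeasure P]
    (μ : EuclideanSpace ℝ (Fin p))
    (X ε : ℕ → Ω → EuclideanSpace ℝ (Fin p))
    -- the model: i.i.d. errors with zero mean in `DS(α₁, …, α_p)`, `1 < α_j ≤ 2`
    (hX : ∀ i ω, X i ω = μ + ε i ω)
    (hindep : iIndepFun ε P)
    (hident : ∀ i, IdentDistrib (ε i) (ε 0) P P)
    (hint : Integrable (ε 0) P) (hmean : ∫ ω, ε 0 ω ∂P = 0)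
    (α : Fin p → ℝ) (hα : ∀ j, 1 < α j ∧ α j ≤ 2)
    (hDS : InDS α P ε)
    -- (A1)
    (ρ : Fin p → ℝ → ℝ)
    (hconv : ∀ j, ConvexOn ℝ Set.univ (ρ j))
    (hdiff : ∀ j, Differentiable ℝ (ρ j))
    (hdiff2 : ∀ j, Differentiable ℝ (deriv (ρ j)))
    -- (A2)
    (hψ_sq : ∀ j, MemLp (fun ω => deriv (ρ j) (ε 0 ω j)) 2 P)
    (hψ_mean : ∀ j, ∫ ω, deriv (ρ j) (ε 0 ω j) ∂P = 0)
    (hψ'_int : ∀ j, Integrable (fun ω => deriv (deriv (ρ j)) (ε 0 ω j)) P)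
    (hψ'_ne : ∀ j, ∫ ω, deriv (deriv (ρ j)) (ε 0 ω j) ∂P ≠ 0)
    -- (A3)
    (hψ'_lip : ∀ j, ∃ K : NNReal, LipschitzWith K (deriv (deriv (ρ j))))
    -- the M-estimators
    (μhat : ℕ → Ω → EuclideanSpace ℝ (Fin p))
    (hμhat_meas : ∀ n, AEMeasurable (μhat n) P)
    (hμhat : ∀ n, ∀ᵐ ω ∂P, IsMEstimate ρ n (fun i => X i ω) (μhat n ω)) :
    (∀ j k, gammaMatrix ρ P (ε 0) j k =
      cov[fun ω => deriv (ρ j) (ε 0 ω j), fun ω => deriv (ρ k) (ε 0 ω k); P]) ∧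
    (asymptoticCov ρ P (ε 0)).PosSemidef ∧
    TendstoInDistribution (fun (n : ℕ) ω => √(n : ℝ) • (μhat n ω - μ)) atTop id (fun _ => P)
      (multivariateGaussian 0 (asymptoticCov ρ P (ε 0))) := by
  have hmono (j : Fin p) : Monotone (deriv (ρ j)) :=
    monotoneOn_univ.1 ((hconv j).monotoneOn_deriv fun x _ => hdiff j x)
  have hpos (j : Fin p) : 0 < ∫ ω, deriv (deriv (ρ j)) (ε 0 ω j) ∂P :=
    lt_of_le_of_ne (integral_nonneg fun ω => (hmono j).deriv_nonneg) (hψ'_ne j).symm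
  have hψm (j : Fin p) : Measurable (deriv (ρ j)) := (hdiff2 j).continuous.measurable
  have hγ (j k : Fin p) : gammaMatrix ρ P (ε 0) j k =
      cov[fun ω => deriv (ρ j) (ε 0 ω j), fun ω => deriv (ρ k) (ε 0 ω k); P] := by
    rw [covariance_eq_sub (hψ_sq j) (hψ_sq k), hψ_mean j, zero_mul, sub_zero]
    rfl
  -- The influence function: dividing by `E ψ'` makes the sandwich matrix the plain covariance of `g
  -- (ε 0)`.
  let g : EuclideanSpace ℝ (Fin p) → EuclideanSpace ℝ (Fin p) := fun x =>
    WithLp.toLp 2 fun j => deriv (ρ j) (x j) / ∫ ω, deriv (deriv (ρ j)) (ε 0 ω j) ∂P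
  have hg : Measurable g := by fun_prop
  have hL2 (j : Fin p) : MemLp (fun ω => g (ε 0 ω) j) 2 P := by
    simpa [g, div_eq_mul_inv] using (hψ_sq j).mul_const _
  have hS : asymptoticCov ρ P (ε 0) =
      Matrix.of fun j k => cov[fun ω => g (ε 0 ω) j, fun ω => g (ε 0 ω) k; P] := by
    ext j k
    simp only [asymptoticCov_apply hψ'_ne, Matrix.of_apply, g, covariance_fun_div_left,
      covariance_fun_div_right, hγ]
    ring
  refine ⟨hγ, hS ▸ posSemidef_covariance hL2, ?_⟩
  have hclt := tendstoInDistribution_inv_sqrt_smul_sum (W := fun i ω => g (ε i ω))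
    (hindep.comp (fun _ => g) fun _ => hg) (fun i => (hident i).comp hg) hL2
    (fun j => by simp [g, integral_div, hψ_mean])
  rw [← hS] at hclt
  -- Slutsky: it remains to show that the linearisation error vanishes in probability.
  refine tendstoInDistribution_of_tendstoInMeasure_sub _ _ hclt ?_ fun n => by fun_prop
  refine tendstoInMeasure_zero_of_coordinates fun j => ?_
  obtain ⟨K, hK⟩ := hψ'_lip j
  have hcoord : Measurable fun x : EuclideanSpace ℝ (Fin p) => x j := by fun_prop
  have hlin := tendstoInMeasure_sqrt_mul_root_sub (ξ := fun i ω => ε i ω j)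
    (hindep.comp (fun _ x => x j) fun _ => hcoord) (fun i => (hident i).comp hcoord) (hmono j)
    (hdiff2 j) hK (hψ_sq j) (hψ_mean j) (hψ'_int j) (hpos j)
    (δ := fun n ω => μhat n ω j - μ j) (fun n => by
      filter_upwards [hμhat n] with ω hω
      rw [← hω.sum_deriv_eq_zero hdiff j]
      refine Finset.sum_congr rfl fun i _ => congrArg _ ?_
      simp only [hX, PiLp.add_apply]
      ring)
  convert hlin using 3 with n ω
  simp [g, Finset.sum_div, mul_div_assoc]
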